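/- Let $l,w\ge 1$ be integers and $i\in\{1,2\}$. The hammock network $H_{l,w}^{(i)}$ of kind $i$ and dimensions $(l,w)$ is the graph whose nodes are the lattice points $(x,y)\in\mathbb{Z}^2$ with $0\le x\le l$, $0\le y\le w$ and $x+y$ even (if $i=1$), respectively odd (if $i=2$), and whose edge set $E$ consists of all segments joining two nodes $(x,y)$, $(x',y')$ with $|x-x'|=|y-y'|=1$. The source nodes are the nodes with $x=0$ and the terminus nodes are the nodes with $x=l$. A pathset is a subset $P\subseteq E$ that contains all the edges of some path (with pairwise distinct nodes) from a source node to a terminus node. Let $h=h_{l,w}^{(i)}$ be the reliability polynomial \[ h(p)=\sum_{P \text{ pathset}} p^{|P|}(1-p)^{n-|P|},\qquad n=|E|=lw. \] Then \[ h^{(k)}(0)=0\quad\text{for all } k=0,1,\ldots,l-1, \] and \[ h(1)=1,\qquad h^{(k)}(1)=0\quad\text{for all } k=1,2,\ldots,w-1. \] -/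

import Mathlib

namespace Hammock

/-- The four diagonal steps `(±1, ±1)` allowed in an X-path. -/
def steps : Finset (ℤ × ℤ) := {(1, 1), (-1, 1), (1, -1), (-1, -1)}

/-- The graph on all lattice points of the plane in which two points are adjacent when they
differ by a diagonal step. An X-path (a sequence of pairwise distinct lattice points with
consecutive differences in `steps`) is precisely a path of this graph. -/
def xLattice : SimpleGraph (ℤ × ℤ) where
  Adj u v := v - u ∈ steps
  symm := ⟨by
    intro u v h
    simp only [steps, Finset.mem_insert, Finset.mem_singleton, Prod.ext_iff, Prod.fst_sub,
      Prod.snd_sub] at h ⊢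
    omega⟩
  loopless := ⟨by
    intro u h
    simp [steps, Prod.ext_iff] at h⟩

instance : DecidableRel xLattice.Adj := fun u v =>
  inferInstanceAs (Decidable (v - u ∈ steps))

/-- The two kinds of hammock networks. -/
inductive Kind : Type
  | first : Kind
  | second : Kind

/-- Networks of the first kind use the even lattice points (`x + y` even), those of the second
kind the odd ones. -/
def Kind.HasParity : Kind → ℤ × ℤ → Prop
  | .first, v => Even (v.1 + v.2)
  | .second, v => Odd (v.1 + v.2)

instance (i : Kind) : DecidablePred i.HasParity := fun v =>
  match i with
  | .first => inferInstanceAs (Decidable (Even (v.1 + v.2)))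
  | .second => inferInstanceAs (Decidable (Odd (v.1 + v.2)))

/-- The lattice points of the rectangle `[0, l] × [0, w]`. -/
noncomputable def rectangle (l w : ℕ) : Finset (ℤ × ℤ) := Finset.Icc 0 (l : ℤ) ×ˢ Finset.Icc 0 (w : ℤ)

/-- The nodes of the hammock network of kind `i` and dimensions `(l, w)`. -/
noncomputable def nodes (l w : ℕ) (i : Kind) : Finset (ℤ × ℤ) := (rectangle l w).filter i.HasParity

/-- The edges of the hammock network of kind `i` and dimensions `(l, w)`: the diagonal segments
joining two nodes. (The two ends of a diagonal segment always have the same parity.) -/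
noncomputable def edges (l w : ℕ) (i : Kind) : Finset (Sym2 (ℤ × ℤ)) :=
  (nodes l w i).sym2.filter (· ∈ xLattice.edgeSet)

/-- The source nodes: those on the line `x = 0`. -/
noncomputable def sources (l w : ℕ) (i : Kind) : Finset (ℤ × ℤ) := (nodes l w i).filter (fun v => v.1 = 0)

/-- The terminus nodes: those on the line `x = l`. -/
noncomputable def targets (l w : ℕ) (i : Kind) : Finset (ℤ × ℤ) :=
  (nodes l w i).filter (fun v => v.1 = (l : ℤ))

/-- A set of edges of the network is a pathset if it contains (all the edges of) an X-path that
connects a source node with a terminus node. -/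
def IsPathset (l w : ℕ) (i : Kind) (P : Finset (Sym2 (ℤ × ℤ))) : Prop :=
  P ⊆ edges l w i ∧
    ∃ s ∈ sources l w i, ∃ t ∈ targets l w i, ∃ γ : xLattice.Walk s t,
      γ.IsPath ∧ ∀ e ∈ γ.edges, e ∈ P

open Classical in
/-- The set of all pathsets of the network. -/
noncomputable def pathsets (l w : ℕ) (i : Kind) : Finset (Finset (Sym2 (ℤ × ℤ))) :=
  (edges l w i).powerset.filter (IsPathset l w i)

/-- The reliability polynomial `h(p) = ∑ p ^ |P| (1 - p) ^ (n - |P|)`, where `P` runs over the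
pathsets and `n` is the number of edges of the network. -/
noncomputable def reliability (l w : ℕ) (i : Kind) : Polynomial ℝ :=
  ∑ P ∈ pathsets l w i,
    Polynomial.X ^ P.card * (1 - Polynomial.X) ^ ((edges l w i).card - P.card)

end Hammock

/-! A step changes the abscissa by one, so a pathset has at least `l` edges and `X ^ l` divides
every term of `h` (`IsPathset.le_card`). At 1, expanding `(X + (1 - X)) ^ n = 1` over all edge sets
shows that `1 - h` is the same sum over the non-pathsets. The `w` zigzag paths, one in each strip
between consecutive heights, are edge-disjoint, and a non-pathset misses an edge of each
(`le_card_sub_card_of_not_isPathset`); hence `(X - 1) ^ w` divides `1 - h`. A root of multiplicity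
at least `m` kills all derivatives of order below `m`. -/

open Polynomial in
theorem Polynomial.iteratedDeriv_eval_eq (q : ℝ[X]) (k : ℕ) :
    iteratedDeriv k (fun x : ℝ => q.eval x) = fun x => (derivative^[k] q).eval x := by
  induction k with
  | zero => simp
  | succ k ih =>
    rw [iteratedDeriv_succ, ih]
    funext x
    rw [Polynomial.deriv, Function.iterate_succ_apply']

open Polynomial in
theorem Polynomial.iteratedDeriv_eval_eq_zero_of_pow_dvd {q : ℝ[X]} {a : ℝ} {m k : ℕ}
    (h : (X - C a) ^ m ∣ q) (hk : k < m) :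
    iteratedDeriv k (fun x : ℝ => q.eval x) a = 0 := by
  rw [Polynomial.iteratedDeriv_eval_eq]
  have h1 := Polynomial.pow_sub_dvd_iterate_derivative_of_pow_dvd k h
  have h2 : (X - C a) ∣ derivative^[k] q :=
    (dvd_pow_self _ (by omega)).trans h1
  exact Polynomial.dvd_iff_isRoot.mp h2

/-- Injectivity of `f` is not needed: `bypass` turns the walk into a path and only drops edges. -/
theorem SimpleGraph.exists_isPath_of_adj_succ {V : Type*} (G : SimpleGraph V) (f : ℕ → V)
    (hf : ∀ x, G.Adj (f x) (f (x + 1))) (n : ℕ) :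
    ∃ γ : G.Walk (f 0) (f n), γ.IsPath ∧ ∀ e ∈ γ.edges, ∃ x < n, e = s(f x, f (x + 1)) := by
  classical
  suffices h : ∃ γ : G.Walk (f 0) (f n), ∀ e ∈ γ.edges, ∃ x < n, e = s(f x, f (x + 1)) by
    obtain ⟨γ, hγ⟩ := h
    exact ⟨γ.bypass, γ.bypass_isPath, fun e he => hγ e (γ.edges_bypass_subset_edges he)⟩
  induction n with
  | zero => exact ⟨.nil, by simp⟩
  | succ n ih =>
    obtain ⟨γ, hγ⟩ := ih
    refine ⟨γ.concat (hf n), fun e he => ?_⟩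
    rw [SimpleGraph.Walk.edges_concat, List.concat_eq_append, List.mem_append,
      List.mem_singleton] at he
    rcases he with he | rfl
    · obtain ⟨x, hx, rfl⟩ := hγ e he
      exact ⟨x, by omega, rfl⟩
    · exact ⟨n, by omega, rfl⟩

namespace Hammock

theorem xLattice_adj_iff {u v : ℤ × ℤ} :
    xLattice.Adj u v ↔ (v.1 = u.1 + 1 ∨ v.1 = u.1 - 1) ∧ (v.2 = u.2 + 1 ∨ v.2 = u.2 - 1) := by
  change v - u ∈ steps ↔ _
  simp only [steps, Finset.mem_insert, Finset.mem_singleton, Prod.ext_iff, Prod.fst_sub,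
    Prod.snd_sub]
  omega

theorem fst_sub_fst_le_length {u v : ℤ × ℤ} (γ : xLattice.Walk u v) :
    v.1 - u.1 ≤ γ.length := by
  induction γ with
  | nil => simp
  | cons h γ ih =>
    have := (xLattice_adj_iff.mp h).1
    rw [SimpleGraph.Walk.length_cons]
    push_cast
    omega

theorem IsPathset.le_card {l w : ℕ} {i : Kind} {P : Finset (Sym2 (ℤ × ℤ))}
    (hP : IsPathset l w i P) : l ≤ P.card := by
  classical
  obtain ⟨-, s, hs, t, ht, γ, hγ, hγP⟩ := hP
  have hs0 : s.1 = 0 := (Finset.mem_filter.mp hs).2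
  have htl : t.1 = l := (Finset.mem_filter.mp ht).2
  have hlen := fst_sub_fst_le_length γ
  have hcard : γ.edges.toFinset.card = γ.length := by
    rw [List.toFinset_card_of_nodup hγ.isTrail.edges_nodup, SimpleGraph.Walk.length_edges]
  have hle : γ.edges.toFinset.card ≤ P.card :=
    Finset.card_le_card fun e he => hγP e (List.mem_toFinset.mp he)
  omega

/-- The remainder modulo two of `x + y` at the nodes of a network. -/
def Kind.residue : Kind → ℤ
  | .first => 0
  | .second => 1

theorem Kind.hasParity_iff (i : Kind) (v : ℤ × ℤ) :
    i.HasParity v ↔ (v.1 + v.2) % 2 = i.residue := by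
  cases i
  · exact Int.even_iff
  · exact Int.odd_iff

theorem mem_nodes_iff {l w : ℕ} {i : Kind} {v : ℤ × ℤ} :
    v ∈ nodes l w i ↔
      ((0 ≤ v.1 ∧ v.1 ≤ l) ∧ 0 ≤ v.2 ∧ v.2 ≤ w) ∧ (v.1 + v.2) % 2 = i.residue := by
  simp only [nodes, rectangle, Finset.mem_filter, Finset.mem_product, Finset.mem_Icc,
    Kind.hasParity_iff]

/-- The `x`-th node of the zigzag path between the heights `j` and `j + 1`. -/
def zigzag (i : Kind) (j x : ℕ) : ℤ × ℤ := (x, j + (x + j + i.residue) % 2)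

theorem zigzag_adj (i : Kind) (j x : ℕ) : xLattice.Adj (zigzag i j x) (zigzag i j (x + 1)) := by
  rw [xLattice_adj_iff]
  simp only [zigzag]
  push_cast
  omega

theorem zigzag_mem_nodes {l w : ℕ} (i : Kind) {j x : ℕ} (hj : j < w) (hx : x ≤ l) :
    zigzag i j x ∈ nodes l w i := by
  rw [mem_nodes_iff]
  -- The coordinate sum is `x + j + (x + j + residue) % 2`, congruent to `residue` mod 2.
  cases i <;> simp only [zigzag, Kind.residue] <;> omega

theorem zigzag_edge_mem_edges {l w : ℕ} (i : Kind) {j x : ℕ} (hj : j < w) (hx : x < l) :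
    s(zigzag i j x, zigzag i j (x + 1)) ∈ edges l w i := by
  rw [edges, Finset.mem_filter, Finset.mk_mem_sym2_iff]
  exact ⟨⟨zigzag_mem_nodes i hj hx.le, zigzag_mem_nodes i hj hx⟩, zigzag_adj i j x⟩

/-- The ends of the edge have heights `j` and `j + 1` in some order, so the lower one determines
`j`. -/
theorem eq_of_zigzag_edge_eq {i : Kind} {j j' x x' : ℕ}
    (h : s(zigzag i j x, zigzag i j (x + 1)) = s(zigzag i j' x', zigzag i j' (x' + 1))) :
    j = j' := by
  simp only [Sym2.eq_iff, zigzag, Prod.ext_iff] at h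
  push_cast at h
  omega

theorem isPathset_of_zigzag_subset {l w : ℕ} {i : Kind} {P : Finset (Sym2 (ℤ × ℤ))}
    (hP : P ⊆ edges l w i) {j : ℕ} (hj : j < w)
    (h : ∀ x < l, s(zigzag i j x, zigzag i j (x + 1)) ∈ P) : IsPathset l w i P := by
  obtain ⟨γ, hγ, hγe⟩ := xLattice.exists_isPath_of_adj_succ (zigzag i j) (zigzag_adj i j) l
  refine ⟨hP, zigzag i j 0, ?_, zigzag i j l, ?_, γ, hγ, fun e he => ?_⟩
  · exact Finset.mem_filter.mpr ⟨zigzag_mem_nodes i hj (Nat.zero_le l), rfl⟩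
  · exact Finset.mem_filter.mpr ⟨zigzag_mem_nodes i hj le_rfl, rfl⟩
  · obtain ⟨x, hx, rfl⟩ := hγe e he
    exact h x hx

theorem le_card_sub_card_of_not_isPathset {l w : ℕ} {i : Kind} {P : Finset (Sym2 (ℤ × ℤ))}
    (hP : P ⊆ edges l w i) (h : ¬ IsPathset l w i P) : w ≤ (edges l w i).card - P.card := by
  classical
  have hmiss : ∀ j : Fin w, ∃ x < l, s(zigzag i j x, zigzag i j (x + 1)) ∉ P := by
    intro j
    by_contra! hj
    exact h (isPathset_of_zigzag_subset hP j.2 hj)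
  choose x hx hxP using hmiss
  rw [← Finset.card_sdiff_of_subset hP]
  calc w = (Finset.univ : Finset (Fin w)).card := by simp
    -- One missing edge chosen per strip; distinct strips give distinct edges.
    _ ≤ (edges l w i \ P).card := Finset.card_le_card_of_injOn
        (fun j : Fin w => s(zigzag i j (x j), zigzag i j (x j + 1)))
        (fun j _ => by
          simpa using ⟨zigzag_edge_mem_edges i j.2 (hx j), hxP j⟩)
        (fun j _ j' _ hjj' => Fin.ext (eq_of_zigzag_edge_eq hjj'))

open Polynomial

theorem X_pow_dvd_reliability (l w : ℕ) (i : Kind) : (X : ℝ[X]) ^ l ∣ reliability l w i := by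
  classical
  refine Finset.dvd_sum fun P hP => Dvd.dvd.mul_right (pow_dvd_pow _ ?_) _
  exact (Finset.mem_filter.mp hP).2.le_card

open Classical in
theorem one_sub_reliability (l w : ℕ) (i : Kind) :
    1 - reliability l w i = ∑ P ∈ (edges l w i).powerset with ¬ IsPathset l w i P,
      (X : ℝ[X]) ^ P.card * (1 - X) ^ ((edges l w i).card - P.card) := by
  have htotal := Finset.sum_pow_mul_eq_add_pow (X : ℝ[X]) (1 - X) (edges l w i)
  rw [add_sub_cancel, one_pow, ← Finset.sum_filter_add_sum_filter_not _ (IsPathset l w i)]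
    at htotal
  rw [sub_eq_iff_eq_add']
  exact htotal.symm

theorem X_sub_one_pow_dvd_one_sub_reliability (l w : ℕ) (i : Kind) :
    (X - C 1 : ℝ[X]) ^ w ∣ 1 - reliability l w i := by
  classical
  rw [one_sub_reliability]
  refine Finset.dvd_sum fun P hP => Dvd.dvd.mul_left ?_ _
  obtain ⟨hPE, hP⟩ := Finset.mem_filter.mp hP
  have hdvd : (X - C 1 : ℝ[X]) ∣ 1 - X := ⟨-1, by simp⟩
  exact (pow_dvd_pow_of_dvd hdvd w).trans
    (pow_dvd_pow _ (le_card_sub_card_of_not_isPathset (Finset.mem_powerset.mp hPE) hP))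

end Hammock

theorem corollary4 (l w : ℕ) (hl : 1 ≤ l) (hw : 1 ≤ w) (i : Hammock.Kind) :
    (∀ k : ℕ, k < l →
      iteratedDeriv k (fun p : ℝ => (Hammock.reliability l w i).eval p) 0 = 0) ∧
    (Hammock.reliability l w i).eval 1 = 1 ∧
    (∀ k : ℕ, 1 ≤ k → k < w →
      iteratedDeriv k (fun p : ℝ => (Hammock.reliability l w i).eval p) 1 = 0) := by
  have h0 := Hammock.X_pow_dvd_reliability l w i
  have h1 := Hammock.X_sub_one_pow_dvd_one_sub_reliability l w i
  refine ⟨fun k hk => ?_, ?_, fun k hk hkw => ?_⟩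
  · exact Polynomial.iteratedDeriv_eval_eq_zero_of_pow_dvd (by simpa using h0) hk
  · have h := Polynomial.iteratedDeriv_eval_eq_zero_of_pow_dvd h1 hw
    simp only [iteratedDeriv_zero, Polynomial.eval_sub, Polynomial.eval_one] at h
    linarith
  · have h := Polynomial.iteratedDeriv_eval_eq_zero_of_pow_dvd h1 hkw
    -- For `k ≥ 1` the constant 1 disappears, leaving minus the derivative of `h`.
    simp only [Polynomial.iteratedDeriv_eval_eq, Polynomial.iterate_derivative_sub,
      Polynomial.iterate_derivative_one hk] at h ⊢
    simpa using h
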